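/- Throughout, $\theta>\omega_1$ is a regular cardinal and $S^\omega_\theta=\{\alpha<\theta:\operatorname{cf}(\alpha)=\omega\}$. A set $\Omega\subseteq\theta$ is \emph{non-reflecting} if there is no $\delta<\theta$ of uncountable cofinality such that $\Omega\cap\delta$ is stationary in $\delta$. A \emph{$C$-sequence} of length $\theta$ is a sequence $\vec C=\langle C_\alpha:\alpha<\theta\rangle$ such that $C_\alpha$ is closed and cofinal in $\alpha$ for every limit $\alpha<\theta$ and $C_{\alpha+1}=\{\alpha\}$; it \emph{avoids} $\Omega$ if $C_\alpha\cap\Omega=\emptyset$ for every limit $\alpha<\theta$. Todorčević's trace function of $\vec C$ is defined for $\alpha\le\beta<\theta$ by $\operatorname{tr}(\alpha,\alpha)=\emptyset$ and $\operatorname{tr}(\alpha,\beta)=\operatorname{tr}(\alpha,\min(C_\beta\setminus\alpha))\cup\{\beta\}$ for $\alpha<\beta$. For an ordinal $\delta\le\theta$ of uncountable cofinality, $\mathcal H(\vec C\restriction\delta)$ is the collection of all $X\subseteq\delta$ such that for every closed unbounded $E\subseteq\delta$ there are $\alpha<\beta$ in $E$ with $\operatorname{tr}(\alpha,\beta)\cap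 X\neq\emptyset$. A set $X\in\mathcal H(\vec C)$ \emph{trace reflects at} $\delta$ (with respect to $\vec C$), where $\delta<\theta$ has uncountable cofinality, if $X\cap\delta\in\mathcal H(\vec C\restriction\delta)$. The Set Mapping Reflection Principle $\mathrm{MRP}$ is the following statement. Let $X$ be an uncountable set and let $\kappa$ be a regular cardinal such that $[X]^\omega\in H(\kappa)$, where $[X]^\omega$ is the set of countable subsets of $X$ and $H(\kappa)$ is the collection of sets of hereditary cardinality less than $\kappa$. Give $[X]^\omega$ the Ellentuck topology, generated by the intervals $[x,N]=\{Y\in[X]^\omega:x\subseteq Y\subseteq N\}$ with $N\in[X]^\omega$ and $x\subseteq N$ finite. Let $\Sigma$ be a function whose domain is a closed unbounded subset of $[H(\kappa)]^\omega$ consisting of countable elementary submodels of $H(\kappa)$, such that for every $M$ in the domain, $\Sigma(M)\subseteq[X]^\omega$ is open and $M$-stationary, that is, $E\cap\Sigma(M)\cap M\neq\emptyset$ for every closed unbounded $E\subseteq[X]^\omega$ with $E\in M$. Then there is a continuous $\in$-chain $\langle N_\nu:\nu<\omega_1\rangle$ in the domain of $\Sigma$ such that for every limit ordinal $0<\nu<\omega_1$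 there is $\nu_0<\nu$ with $N_\xi\cap X\in\Sigma(N_\nu)$ whenever $\nu_0<\xi<\nu$. \textbf{Theorem.} Assume $\mathrm{MRP}$. Let $\theta>\omega_1$ be a regular cardinal, let $\Omega\subseteq S^\omega_\theta$ be a non-reflecting stationary subset of $\theta$, and let $\vec C$ be a $C$-sequence of length $\theta$ that avoids $\Omega$. If $\mathcal F$ is a collection of stationary subsets of $\theta$, each contained in $\Omega$, and $|\mathcal F|=\omega_1$, then there is a single $\delta<\theta$ of cofinality $\omega_1$ such that every $X\in\mathcal F$ belongs to $\mathcal H(\vec C)$ and trace reflects at $\delta$ with respect to $\vec C$. -/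

import Mathlib

universe u

namespace TraceReflection

open Set Cardinal Ordinal

/-! ### Clubs and stationary sets of ordinals, walks and the trace function -/

/-- `S ∩ δ` is a stationary subset of the ordinal `δ`. -/
def StationaryIn (δ : Ordinal.{u}) (S : Set Ordinal.{u}) : Prop :=
  IsStationary (Subtype.val ⁻¹' S : Set (Iio δ))

/-- `E` is a closed and cofinal (unbounded) subset of the ordinal `δ`. -/
def ClubIn (δ : Ordinal.{u}) (E : Set Ordinal.{u}) : Prop :=
  E ⊆ Iio δ ∧ IsClub (Subtype.val ⁻¹' E : Set (Iio δ))

/-- `S` reflects below `θ`: for some `δ < θ` of uncountable cofinality, `S ∩ δ` is stationary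
in `δ`. -/
def Reflects (θ : Ordinal.{u}) (S : Set Ordinal.{u}) : Prop :=
  ∃ δ < θ, ℵ₀ < δ.cof ∧ StationaryIn δ S

/-- The set of ordinals below `θ` of countably infinite cofinality. -/
def cofOmega (θ : Ordinal.{u}) : Set Ordinal.{u} :=
  {α | α < θ ∧ α.cof = ℵ₀}

/-- `⟨C α : α < θ⟩` is a `C`-sequence of length `θ`. Only the values `C α` with `0 < α < θ`
matter, so that the restriction of `C` to `δ ≤ θ` is the same function, regarded as having
length `δ`. -/
structure IsCSequence (C : Ordinal.{u} → Set Ordinal.{u}) (θ : Ordinal.{u}) : Prop where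
  club_of_isSuccLimit : ∀ α < θ, Order.IsSuccLimit α → ClubIn α (C α)
  add_one : ∀ α, α + 1 < θ → C (α + 1) = {α}

/-- The `C`-sequence `C` of length `θ` avoids `Ω`. -/
def Avoids (C : Ordinal.{u} → Set Ordinal.{u}) (θ : Ordinal.{u}) (Ω : Set Ordinal.{u}) : Prop :=
  ∀ α < θ, Order.IsSuccLimit α → Disjoint (C α) Ω

/-- `MemTrace C α β ξ`: the ordinal `ξ` is visited in the walk from `β` down to `α` along `C`,
the destination `α` being omitted. -/
inductive MemTrace (C : Ordinal.{u} → Set Ordinal.{u}) (α : Ordinal.{u}) :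
    Ordinal.{u} → Ordinal.{u} → Prop
  | start (β : Ordinal.{u}) : α < β → MemTrace C α β β
  | step (β ξ : Ordinal.{u}) : α < β → MemTrace C α (sInf (C β \ Iio α)) ξ → MemTrace C α β ξ

/-- The trace function `tr(α, β)`; see `tr_self` and `tr_of_lt` for its recursive equations. -/
def tr (C : Ordinal.{u} → Set Ordinal.{u}) (α β : Ordinal.{u}) : Set Ordinal.{u} :=
  {ξ | MemTrace C α β ξ}

theorem tr_self (C : Ordinal.{u} → Set Ordinal.{u}) (α : Ordinal.{u}) : tr C α α = ∅ := by
  ext ξ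
  simp only [tr, mem_ofPred_eq, mem_empty_iff_false, iff_false]
  intro h
  cases h with
  | start _ h => exact lt_irrefl _ h
  | step _ _ h _ => exact lt_irrefl _ h

theorem tr_of_lt (C : Ordinal.{u} → Set Ordinal.{u}) {α β : Ordinal.{u}} (h : α < β) :
    tr C α β = tr C α (sInf (C β \ Iio α)) ∪ {β} := by
  ext ξ
  simp only [tr, mem_ofPred_eq, mem_union, mem_singleton_iff]
  constructor
  · intro hξ
    cases hξ with
    | start _ _ => exact Or.inr rfl
    | step _ _ _ h' => exact Or.inl h'
  · rintro (h' | rfl)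
    · exact .step _ _ h h'
    · exact .start _ h

/-- The collection `ℋ(C)` for the `C`-sequence `C` of length `θ`: those `X ⊆ θ` such that every
club `E ⊆ θ` has elements `α < β` with `tr(α, β) ∩ X` nonempty. -/
def traceHitting (C : Ordinal.{u} → Set Ordinal.{u}) (θ : Ordinal.{u}) : Set (Set Ordinal.{u}) :=
  {X | X ⊆ Iio θ ∧ ∀ E, ClubIn θ E → ∃ α ∈ E, ∃ β ∈ E, α < β ∧ (tr C α β ∩ X).Nonempty}

/-- The element `X` of `ℋ(C)`, where `C` has length `θ`, trace reflects at `δ`. -/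
def TraceReflectsAt (C : Ordinal.{u} → Set Ordinal.{u}) (θ : Ordinal.{u}) (X : Set Ordinal.{u})
    (δ : Ordinal.{u}) : Prop :=
  X ∈ traceHitting C θ ∧ δ < θ ∧ ℵ₀ < δ.cof ∧ X ∩ Iio δ ∈ traceHitting C δ

/-! ### The Set Mapping Reflection Principle

The ambient universe of sets is `ZFSet.{u}`. -/

/-- `[A]^ω`, the collection of countable subsets of `A` (a set or a class). -/
def countableSubsets (A : Set ZFSet.{u}) : Set ZFSet.{u} :=
  {Y | (Y : Set ZFSet.{u}) ⊆ A ∧ (Y : Set ZFSet.{u}).Countable}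

/-- `[X]^ω` as a set. -/
noncomputable def countableSubsetsSet (X : ZFSet.{u}) : ZFSet.{u} :=
  X.powerset.sep fun Y => (Y : Set ZFSet.{u}).Countable

theorem coe_countableSubsetsSet (X : ZFSet.{u}) :
    (countableSubsetsSet X : Set ZFSet.{u}) = countableSubsets (X : Set ZFSet.{u}) := by
  ext Y
  simp [countableSubsetsSet, countableSubsets]

/-- `E` is closed and unbounded in `[A]^ω`: every countable subset of `A` is contained in an
element of `E`, and `E` is closed under unions of increasing `ω`-sequences. -/
structure ClubInCountableSubsets (A E : Set ZFSet.{u}) : Prop where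
  subset : E ⊆ countableSubsets A
  unbounded : ∀ Y ∈ countableSubsets A, ∃ Z ∈ E, Y ⊆ Z
  closed : ∀ Y : ℕ → ZFSet.{u}, (∀ n, Y n ∈ E) → (∀ n, Y n ⊆ Y (n + 1)) → ZFSet.iUnion Y ∈ E

/-- The Ellentuck topology on `[X]^ω`, generated by the intervals
`[x, N] = {Y | x ⊆ Y ⊆ N}` with `N ∈ [X]^ω` and `x` a finite subset of `N`. -/
@[reducible]
def ellentuck (X : ZFSet.{u}) : TopologicalSpace (countableSubsets (X : Set ZFSet.{u})) :=
  TopologicalSpace.generateFrom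
    {U | ∃ x N : ZFSet.{u}, N ∈ countableSubsets (X : Set ZFSet.{u}) ∧ x ⊆ N ∧
      (x : Set ZFSet.{u}).Finite ∧ U = {Y | x ⊆ Y.1 ∧ Y.1 ⊆ N}}

/-- `S` is a subset of `[X]^ω` which is open in the Ellentuck topology. -/
def EllentuckOpen (X : ZFSet.{u}) (S : Set ZFSet.{u}) : Prop :=
  S ⊆ countableSubsets (X : Set ZFSet.{u}) ∧ (ellentuck X).IsOpen (Subtype.val ⁻¹' S)

/-- `H(κ)`: the sets of hereditary cardinality less than `κ`, that is, the sets whose transitive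
closure has fewer than `κ` elements. -/
def hereditary (κ : Cardinal.{u}) : Set ZFSet.{u} :=
  {x | ∃ t : ZFSet.{u}, t.IsTransitive ∧ x ⊆ t ∧ t.card < κ}

/-- The relation symbols of the language of set theory. -/
inductive SetRel : ℕ → Type
  | mem : SetRel 2

/-- The first-order language of set theory, with one binary relation symbol. -/
def setLanguage : FirstOrder.Language.{0, 0} := ⟨fun _ => Empty, SetRel⟩

/-- A collection of sets as a structure `(A, ∈)` for the language of set theory. -/
instance membershipStructure (A : Set ZFSet.{u}) : setLanguage.Structure A where
  funMap := fun f => Empty.elim f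
  RelMap
    | .mem => fun v => (v 0).1 ∈ (v 1).1

/-- `M` is a countable elementary submodel of `(H(κ), ∈)`. -/
def CountableElementary (κ : Cardinal.{u}) (M : ZFSet.{u}) : Prop :=
  M ∈ countableSubsets (hereditary κ) ∧
    ∃ S : setLanguage.ElementarySubstructure (hereditary κ),
      ∀ x : hereditary κ, x ∈ S ↔ x.1 ∈ M

/-- `S ⊆ [X]^ω` is `M`-stationary: `E ∩ S ∩ M` is nonempty for every club `E ⊆ [X]^ω`
that is an element of `M`. -/
def MStationary (X M : ZFSet.{u}) (S : Set ZFSet.{u}) : Prop :=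
  ∀ E ∈ M, ClubInCountableSubsets (X : Set ZFSet.{u}) (E : Set ZFSet.{u}) →
    ∃ Y ∈ E, Y ∈ S ∧ Y ∈ M

/-- `F`, with domain `D`, is an open stationary set mapping (with respect to `X` and `H(κ)`)
that is defined on a club: `D` is a club in `[H(κ)]^ω` which consists of countable elementary
submodels of `H(κ)`, and `F M ⊆ [X]^ω` is open and `M`-stationary for all `M ∈ D`. -/
structure OpenStationaryMapping (X : ZFSet.{u}) (κ : Cardinal.{u}) (D : Set ZFSet.{u})
    (F : ZFSet.{u} → Set ZFSet.{u}) : Prop where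
  club : ClubInCountableSubsets (hereditary κ) D
  elementary : ∀ M ∈ D, CountableElementary κ M
  isOpen : ∀ M ∈ D, EllentuckOpen X (F M)
  stationary : ∀ M ∈ D, MStationary X M (F M)

/-- `⟨N ν : ν < ω₁⟩` is a reflecting sequence for the set mapping `F` with domain `D`: it is a
continuous `∈`-chain in `D` such that for every limit `ν`, `N ξ ∩ X ∈ F (N ν)` for coboundedly
many `ξ < ν`. -/
structure ReflectingSequence (X : ZFSet.{u}) (D : Set ZFSet.{u}) (F : ZFSet.{u} → Set ZFSet.{u})
    (N : Ordinal.{u} → ZFSet.{u}) : Prop where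
  mem_domain : ∀ ν < ω₁, N ν ∈ D
  chain : ∀ ν < ω₁, ∀ ξ < ν, N ξ ∈ N ν
  continuous : ∀ ν < ω₁, Order.IsSuccLimit ν → ∀ z, z ∈ N ν ↔ ∃ ξ < ν, z ∈ N ξ
  reflects : ∀ ν < ω₁, Order.IsSuccLimit ν → ∃ ν₀ < ν, ∀ ξ, ν₀ < ξ → ξ < ν → N ξ ∩ X ∈ F (N ν)

/-- The Set Mapping Reflection Principle: every open stationary set mapping that is defined on
a club reflects. -/
def MRP : Prop :=
  ∀ (X : ZFSet.{u}) (κ : Cardinal.{u}) (D : Set ZFSet.{u}) (F : ZFSet.{u} → Set ZFSet.{u}),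
    ¬ (X : Set ZFSet.{u}).Countable → κ.IsRegular → countableSubsetsSet X ∈ hereditary κ →
    OpenStationaryMapping X κ D F → ∃ N, ReflectingSequence X D F N

end TraceReflection

namespace TraceReflection

open Set Cardinal Ordinal

/-! ### Clubs and stationary sets of ordinals -/

/-! Since `C` avoids `Ω`, a point γ ∈ `Ω` is unavoidable: for each β ≥ γ, all walks from β to points
in some final segment of γ visit γ (`exists_forall_mem_tr`). `MRP` is applied to θ and the mapping
that sends M to the family of countable Z ⊆ θ such that, for some γ < sup(M ∩ θ) in a prescribed X ∈
`F`, Z is bounded below γ and has an element η < γ from which on all walks from sup(M ∩ θ) to points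
below γ visit γ. One element and an upper bound witness this, so the family is Ellentuck open. It is
M-stationary because M contains, for each club E ∈ M, some γ ∈ X and countably many members of E,
each bounded below γ, whose elements are together cofinal in γ (`exists_seq_mem_club`); here cf(γ) =
ω is needed. If N_ξ ∩ θ belongs to the family of N_ν, then sup(N_ξ ∩ θ) lies in the final segment of
γ, so the walk to it from sup(N_ν ∩ θ) meets X.

A single reflecting sequence has to serve all ω₁ members of `F`. So the X used at M is coded by
g(sup(M ∩ ω₁)), where g is regressive and every member of `F` is coded on a stationary set
(`exists_regressive_stationary_fibers`). Regressivity puts the code into M. With δ the supremum of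
the ordinals sup(N_ν ∩ θ), each club in δ is hit at a suitable ν coding X
(`exists_closurePoint_mem_club`). -/

theorem ClubIn.mem_of_isLUB {δ a : Ordinal.{u}} {E s : Set Ordinal.{u}} (hE : ClubIn δ E)
    (hs : s ⊆ E) (hne : s.Nonempty) (ha : IsLUB s a) (haδ : a < δ) : a ∈ E := by
  let a' : Iio δ := ⟨a, haδ⟩
  suffices a' ∈ (Subtype.val ⁻¹' E : Set (Iio δ)) from this
  refine hE.2.isLUB_mem (t := Subtype.val ⁻¹' s) (fun x hx => hs hx) ?_ ⟨?_, ?_⟩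
  · obtain ⟨x, hx⟩ := hne
    exact ⟨⟨x, hE.1 (hs hx)⟩, hx⟩
  · exact fun x hx => ha.1 hx
  · exact fun b hb => ha.2 fun x hx => @hb ⟨x, hE.1 (hs hx)⟩ hx

theorem ClubIn.exists_ge {δ β : Ordinal.{u}} {E : Set Ordinal.{u}} (hE : ClubIn δ E)
    (hβ : β < δ) : ∃ x ∈ E, β ≤ x := by
  obtain ⟨x, hx, hx'⟩ := hE.2.isCofinal ⟨β, hβ⟩
  exact ⟨x.1, hx, hx'⟩

theorem clubIn_of_isLUB_mem {δ : Ordinal.{u}} {E : Set Ordinal.{u}} (hE : E ⊆ Iio δ)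
    (hclosed : ∀ s ⊆ E, s.Nonempty → ∀ a < δ, IsLUB s a → a ∈ E)
    (hunb : ∀ β < δ, ∃ x ∈ E, β ≤ x) : ClubIn δ E := by
  refine ⟨hE, ⟨fun d hd hne _ a ha => ?_, fun β => ?_⟩⟩
  · refine hclosed (Subtype.val '' d) ?_ (hne.image _) a.1 a.2 ⟨?_, ?_⟩
    · rintro _ ⟨x, hx, rfl⟩
      exact hd hx
    · rintro _ ⟨x, hx, rfl⟩
      exact ha.1 hx
    · intro b hb
      by_contra! h
      have hb' : (⟨b, h.trans a.2⟩ : Iio δ) ∈ upperBounds d := fun x hx => hb ⟨x, hx, rfl⟩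
      exact h.not_ge (ha.2 hb')
  · obtain ⟨x, hx, hx'⟩ := hunb β.1 β.2
    exact ⟨⟨x, hE hx⟩, hx, hx'⟩

theorem StationaryIn.exists_mem {δ : Ordinal.{u}} {S E : Set Ordinal.{u}}
    (hS : StationaryIn δ S) (hE : ClubIn δ E) : ∃ γ ∈ S, γ ∈ E := by
  obtain ⟨x, hx, hx'⟩ := hS hE.2
  exact ⟨x.1, hx, hx'⟩

theorem StationaryIn.mono {δ : Ordinal.{u}} {S T : Set Ordinal.{u}} (hS : StationaryIn δ S)
    (h : ∀ γ < δ, γ ∈ S → γ ∈ T) : StationaryIn δ T :=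
  IsStationary.mono hS fun x hx => h x.1 x.2 hx

theorem exists_forall_lt_of_card_lt_cof {o β : Ordinal.{u}} (hβ : β.card < o.cof)
    {h : Ordinal.{u} → Ordinal.{u}} (hh : ∀ η < o, h η < o) (hβo : β ≤ o) :
    ∃ b < o, ∀ η < β, h η < b := by
  refine ⟨⨆ i : Iio β, (h i + 1), ?_, fun η hη => ?_⟩
  · refine lift_iSup_add_one_lt_of_lt_cof ?_ fun i => hh _ (i.2.trans_le hβo)
    rw [Cardinal.mk_Iio_ordinal, Cardinal.lift_lift, ← lift_cof, Cardinal.lift_lt]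
    exact hβ
  · exact (lt_add_one _).trans_le
      (le_ciSup (f := fun i : Iio β => h i + 1) Ordinal.bddAbove_of_small ⟨η, hη⟩)

/-- The closure points of a function on a regular uncountable cardinal form a club. -/
theorem clubIn_closurePoints {o : Ordinal.{u}} (ho : o.cof.ord = o) (hω : ℵ₀ < o.cof)
    {h : Ordinal.{u} → Ordinal.{u}} (hh : ∀ η < o, h η < o) :
    ClubIn o {γ | γ < o ∧ 0 < γ ∧ ∀ η < γ, h η < γ} := by
  have hlim : Order.IsSuccLimit o := one_lt_cof_iff.1 (one_lt_aleph0.trans hω)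
  refine clubIn_of_isLUB_mem (fun γ hγ => hγ.1) ?_ ?_
  · intro s hs ⟨x, hx⟩ a ha hlub
    refine ⟨ha, (hs hx).2.1.trans_le (hlub.1 hx), fun η hη => ?_⟩
    obtain ⟨y, hy, hηy⟩ := (lt_isLUB_iff hlub).1 hη
    exact ((hs hy).2.2 η hηy).trans_le (hlub.1 hy)
  · intro β hβ
    have key : ∀ γ, ∃ b, γ < o → b < o ∧ γ < b ∧ ∀ η < γ, h η < b := by
      intro γ
      by_cases hγ : γ < o
      · obtain ⟨b, hb, hb'⟩ := exists_forall_lt_of_card_lt_cof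
          (lt_ord.1 (hγ.trans_eq ho.symm)) hh hγ.le
        exact ⟨max b (γ + 1), fun _ => ⟨max_lt hb (hlim.add_one_lt hγ),
          (lt_add_one _).trans_le (le_max_right _ _),
          fun η hη => (hb' η hη).trans_le (le_max_left _ _)⟩⟩
      · exact ⟨0, fun h => absurd h hγ⟩
    choose b hb using key
    let a : ℕ → Ordinal.{u} := fun n => b^[n] β
    have hao : ∀ n, a n < o := by
      intro n
      induction n with
      | zero => exact hβ
      | succ n ih =>
        simp only [a, Function.iterate_succ_apply'] at ih ⊢
        exact (hb _ ih).1
    have hstep : ∀ n, a n < a (n + 1) ∧ ∀ η < a n, h η < a (n + 1) := by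
      intro n
      have := (hb _ (hao n)).2
      simpa only [a, Function.iterate_succ_apply'] using this
    have hle : ∀ n, a n ≤ ⨆ n, a n := fun n => le_ciSup Ordinal.bddAbove_of_small n
    refine ⟨⨆ n, a n, ⟨?_, ?_, ?_⟩, hle 0⟩
    · refine lift_iSup_lt_of_lt_cof ?_ hao
      simpa using hω
    · exact (zero_le (a := a 0)).trans_lt ((hstep 0).1.trans_le (hle 1))
    · intro η hη
      obtain ⟨n, hn⟩ := (lt_ciSup_iff Ordinal.bddAbove_of_small).1 hη
      exact ((hstep n).2 η hn).trans_le (hle _)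

theorem StationaryIn.exists_closurePoint {o : Ordinal.{u}} (ho : o.cof.ord = o)
    (hω : ℵ₀ < o.cof) {S : Set Ordinal.{u}} (hS : StationaryIn o S)
    {h : Ordinal.{u} → Ordinal.{u}} (hh : ∀ η < o, h η < o) :
    ∃ γ ∈ S, γ < o ∧ 0 < γ ∧ ∀ η < γ, h η < γ :=
  hS.exists_mem (clubIn_closurePoints ho hω hh)

theorem isSuccLimit_of_closurePoint {γ : Ordinal.{u}} (h0 : 0 < γ)
    {h : Ordinal.{u} → Ordinal.{u}} (hh : ∀ η < γ, η < h η ∧ h η < γ) : Order.IsSuccLimit γ := by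
  rw [Ordinal.isSuccLimit_iff]
  refine ⟨h0.ne', Order.isSuccPrelimit_of_succ_lt fun η hη => ?_⟩
  exact (Order.succ_le_of_lt (hh η hη).1).trans_lt (hh η hη).2

/-- A stationary set contained in `θ` belongs to `ℋ(C)`. -/
theorem StationaryIn.mem_traceHitting {C : Ordinal.{u} → Set Ordinal.{u}} {o : Ordinal.{u}}
    (ho : o.cof.ord = o) (hω : ℵ₀ < o.cof) {S : Set Ordinal.{u}} (hSo : S ⊆ Iio o)
    (hS : StationaryIn o S) : S ∈ traceHitting C o := by
  have hlim : Order.IsSuccLimit o := one_lt_cof_iff.1 (one_lt_aleph0.trans hω)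
  refine ⟨hSo, fun E hE => ?_⟩
  have hex : ∀ η, ∃ e, η < o → e ∈ E ∧ η < e := by
    intro η
    by_cases hη : η < o
    · obtain ⟨x, hx, hx'⟩ := hE.exists_ge (hlim.add_one_lt hη)
      exact ⟨x, fun _ => ⟨hx, (lt_add_one _).trans_le hx'⟩⟩
    · exact ⟨0, fun h => absurd h hη⟩
  choose e he using hex
  obtain ⟨γ, hγS, hγo, hγ0, hγ⟩ := hS.exists_closurePoint ho hω
    (h := e) fun η hη => hE.1 (he η hη).1
  have hmem : γ ∈ E := by
    refine hE.mem_of_isLUB (s := e '' Iio γ) ?_ ⟨_, 0, hγ0, rfl⟩ ⟨?_, ?_⟩ hγo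
    · rintro _ ⟨η, hη, rfl⟩
      exact (he η (hη.trans hγo)).1
    · rintro _ ⟨η, hη, rfl⟩
      exact (hγ η hη).le
    · intro b hb
      by_contra! h
      exact (hb ⟨b, h, rfl⟩).not_gt (he b (h.trans hγo)).2
  -- The starting point of a walk belongs to its trace, so γ ∈ S ∩ E may itself be the upper end.
  refine ⟨e 0, (he 0 (hγ0.trans hγo)).1, γ, hmem, hγ 0 hγ0, γ, ?_, hγS⟩
  exact .start _ (hγ 0 hγ0)

/-! ### Walks that pass through a point avoided by the `C`-sequence -/

/-- If `C` avoids `Ω` and `γ ∈ Ω`, then a walk from `β` to some `α` in a final segment of `γ`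
passes through `γ`. -/
theorem exists_forall_mem_tr {C : Ordinal.{u} → Set Ordinal.{u}} {θ : Ordinal.{u}}
    {Ω : Set Ordinal.{u}} (hC : IsCSequence C θ) (hCΩ : Avoids C θ Ω) {γ : Ordinal.{u}}
    (hγΩ : γ ∈ Ω) (hγ : Order.IsSuccLimit γ) {β : Ordinal.{u}} (hγβ : γ ≤ β) (hβ : β < θ) :
    ∃ η < γ, ∀ α, η ≤ α → α < γ → γ ∈ tr C α β := by
  induction β using WellFoundedLT.induction with
  | _ β ih =>
  rcases hγβ.eq_or_lt with rfl | hlt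
  · exact ⟨0, hγ.bot_lt, fun α _ hα => .start _ hα⟩
  rcases zero_or_succ_or_isSuccLimit β with rfl | ⟨b, rfl⟩ | hlim
  · simp at hlt
  · have hb : b < Order.succ b := Order.lt_succ b
    have hγb : γ ≤ b := Order.lt_succ_iff.1 hlt
    obtain ⟨η, hη, h⟩ := ih b hb hγb (hb.trans hβ)
    refine ⟨η, hη, fun α hα hαγ => MemTrace.step _ _ (hαγ.trans hlt) ?_⟩
    have hCb : C (Order.succ b) = {b} := hC.add_one b hβ
    have : C (Order.succ b) \ Iio α = {b} := by
      rw [hCb, sdiff_eq_left]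
      simpa using (hαγ.le.trans hγb)
    rw [this, csInf_singleton]
    exact h α hα hαγ
  · have hclub := hC.club_of_isSuccLimit β hβ hlim
    have hnot : γ ∉ C β := fun h => (Set.disjoint_left.1 (hCΩ β hβ hlim)) h hγΩ
    -- The closed set `C β` omits γ, so it is bounded below γ.
    obtain ⟨η₀, hη₀, hbd⟩ : ∃ η₀ < γ, ∀ x ∈ C β, x < γ → x ≤ η₀ := by
      by_contra! hcon
      refine hnot (hclub.mem_of_isLUB (s := {x ∈ C β | x < γ}) (fun x hx => hx.1) ?_ ⟨?_, ?_⟩ hlt)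
      · obtain ⟨x, hx, hx', -⟩ := hcon 0 hγ.bot_lt
        exact ⟨x, hx, hx'⟩
      · exact fun x hx => hx.2.le
      · intro b hb
        by_contra! h
        obtain ⟨x, hx, hx', hbx⟩ := hcon b h
        exact (hb ⟨hx, hx'⟩).not_gt hbx
    set β₁ := sInf (C β \ Iio γ) with hβ₁
    have hmem : β₁ ∈ C β \ Iio γ := by
      obtain ⟨x, hx, hx'⟩ := hclub.exists_ge hlt
      exact csInf_mem ⟨x, hx, not_lt.2 hx'⟩
    have hβ₁β : β₁ < β := hclub.1 hmem.1
    obtain ⟨η₁, hη₁, h⟩ := ih β₁ hβ₁β (not_lt.1 hmem.2) (hβ₁β.trans hβ)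
    refine ⟨max (η₀ + 1) η₁, max_lt (hγ.add_one_lt hη₀) hη₁, fun α hα hαγ =>
      MemTrace.step _ _ (hαγ.trans hlt) ?_⟩
    -- Above η₀ the set `C β` has no point below γ, so the first step of the walk is β₁ whatever α
    -- is.
    have : C β \ Iio α = C β \ Iio γ := by
      ext x
      simp only [Set.mem_sdiff, mem_Iio, not_lt, and_congr_right_iff]
      refine fun hx => ⟨fun hαx => ?_, fun hγx => hαγ.le.trans hγx⟩
      by_contra! hxγ
      exact ((lt_add_one η₀).trans_le ((le_max_left _ _).trans (hα.trans hαx))).not_ge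
        (hbd x hx hxγ)
    rw [this]
    exact h α ((le_max_right _ _).trans hα) hαγ

/-! ### Regressive functions with stationary fibres -/

/-- Ulam's theorem for `ω₁`, in the form of a regressive function. -/
theorem exists_regressive_stationary_fibers {A : Type (u + 1)} [Nonempty A] (hA : #A ≤ ℵ₁) :
    ∃ (g : Ordinal.{u} → Ordinal.{u}) (d : Ordinal.{u} → A), (∀ β, 0 < β → g β < β) ∧
      ∀ a, StationaryIn ω₁ {β | d (g β) = a} := by
  classical
  have hinj : ∀ β : Ordinal.{u}, ∃ f : Ordinal.{u} → ℕ, β < ω₁ → InjOn f (Iio β) := by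
    intro β
    by_cases hβ : β < ω₁
    · have hc : (Iio β).Countable := by
        rw [← le_aleph0_iff_set_countable, Cardinal.mk_Iio_ordinal, lift_le_aleph0, card_le_iff]
        simpa using hβ
      obtain ⟨f, hf⟩ := (Set.countable_iff_exists_injOn).1 hc
      exact ⟨f, fun _ => hf⟩
    · exact ⟨0, fun h => absurd h hβ⟩
  choose f hf using hinj
  -- The Ulam matrix: `g n β` inverts the injection `f β` of β into ω at n.
  let g : ℕ → Ordinal.{u} → Ordinal.{u} := fun n β =>
    if h : ∃ α < β, f β α = n then h.choose else 0
  have hg : ∀ n β, 0 < β → g n β < β := by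
    intro n β hβ
    by_cases h : ∃ α < β, f β α = n
    · simp only [g, dif_pos h]
      exact h.choose_spec.1
    · simp only [g, dif_neg h]
      exact hβ
  have hg' : ∀ α β, α < β → β < ω₁ → g (f β α) β = α := by
    intro α β hα hβ
    have h : ∃ α' < β, f β α' = f β α := ⟨α, hα, rfl⟩
    simp only [g, dif_pos h]
    exact hf β hβ h.choose_spec.1 hα h.choose_spec.2
  have hcof : Order.cof (Iio (ω₁ : Ordinal.{u})) = ℵ₁ := by
    rw [cof_Iio, ← lift_cof, cof_omega_one]; simp
  have hst : ∀ α : Iio (ω₁ : Ordinal.{u}), ∃ n, StationaryIn ω₁ {β | g n β = α} := by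
    intro α
    have hlim : Order.IsSuccLimit (ω₁ : Ordinal.{u}) := isSuccLimit_omega 1
    -- Every β > α lies in the fibre of α for some n, and a countable union of nonstationary sets is
    -- nonstationary.
    have h1 : IsStationary (⋃ n, (Subtype.val ⁻¹' {β | g n β = α} : Set (Iio ω₁))) := by
      refine .of_not_isCofinal_compl fun hcon => ?_
      obtain ⟨x, hx, hx'⟩ := hcon ⟨α + 1, hlim.add_one_lt α.2⟩
      refine hx (mem_iUnion.2 ⟨f x.1 α, ?_⟩)
      exact hg' _ _ ((lt_add_one α.1).trans_le hx') x.2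
    refine (isStationary_iUnion_iff_of_countable ?_).1 h1
    rw [hcof]
    exact aleph0_lt_aleph_one.ne'
  choose n hn using hst
  -- Uncountably many α share one m; these α serve as codes for the elements of `A`.
  obtain ⟨m, hm⟩ : ∃ m, ¬ (n ⁻¹' {m}).Countable := by
    by_contra! hcon
    have : (⋃ m, n ⁻¹' {m}).Countable := countable_iUnion hcon
    have huniv : (⋃ m, n ⁻¹' {m}) = Set.univ := by ext; simp
    rw [huniv, Set.countable_univ_iff, ← mk_le_aleph0_iff, Cardinal.mk_Iio_ordinal, lift_le_aleph0] at this
    simp at this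
  have hle : #A ≤ #(n ⁻¹' {m}) := by
    refine hA.trans ?_
    rw [← succ_aleph0, Order.succ_le_iff, ← not_le, le_aleph0_iff_set_countable]
    exact hm
  obtain ⟨e⟩ := hle
  let d : Ordinal.{u} → A := fun i =>
    if h : ∃ a, ((e a).1 : Ordinal.{u}) = i then h.choose else Classical.arbitrary A
  have hd : ∀ a, d (e a).1 = a := by
    intro a
    have h : ∃ a', ((e a').1 : Ordinal.{u}) = (e a).1 := ⟨a, rfl⟩
    simp only [d, dif_pos h]
    exact e.injective (Subtype.ext (Subtype.ext h.choose_spec))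
  refine ⟨g m, d, hg m, fun a => (hn (e a).1).mono fun γ _ hγ => ?_⟩
  have hma : n (e a).1 = m := (e a).2
  rw [hma] at hγ
  have hγ' : g m γ = (e a).1 := hγ
  show d (g m γ) = a
  rw [hγ', hd]

/-! ### Clubs of countable elementary submodels -/

/-- The function symbols of the language with countably many binary functions. -/
inductive BinaryFun : ℕ → Type
  | mk (n : ℕ) : BinaryFun 2

/-- The language with countably many binary functions. -/
def binaryLanguage : FirstOrder.Language.{0, 0} := ⟨BinaryFun, fun _ => Empty⟩

/-- The structure for `binaryLanguage` given by a sequence of binary functions. -/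
@[reducible]
def binaryStructure {A : Type*} (g : ℕ → A → A → A) : binaryLanguage.Structure A where
  funMap
    | .mk n => fun v => g n (v 0) (v 1)
  RelMap := fun r => Empty.elim r

/-- The language of set theory with Skolem functions and countably many binary functions. -/
abbrev skolemBinaryLanguage : FirstOrder.Language.{0, 0} :=
  (setLanguage.sum setLanguage.skolem₁).sum binaryLanguage

instance : Countable (Σ l, setLanguage.Functions l) :=
  have : IsEmpty (Σ l, setLanguage.Functions l) := ⟨fun x => Empty.elim x.2⟩
  inferInstance

instance : Countable (Σ l, setLanguage.Relations l) := by
  refine Function.Injective.countable (f := fun _ => ()) ?_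
  rintro ⟨_, ⟨⟩⟩ ⟨_, ⟨⟩⟩ _
  rfl

instance : Countable (Σ l, binaryLanguage.Functions l) := by
  refine Function.Surjective.countable (f := fun n : ℕ => ⟨2, BinaryFun.mk n⟩) ?_
  rintro ⟨_, ⟨n⟩⟩
  exact ⟨n, rfl⟩

instance : Countable (Σ l, skolemBinaryLanguage.Functions l) := by
  have h1 : Countable (Σ l, (setLanguage.sum setLanguage.skolem₁).Functions l) := by
    rw [← mk_le_aleph0_iff]
    refine FirstOrder.Language.card_functions_sum_skolem₁_le.trans ?_
    rw [max_le_iff]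
    refine ⟨le_rfl, ?_⟩
    rw [FirstOrder.Language.card_eq_card_functions_add_card_relations]
    simp only [← mk_sigma, Cardinal.lift_id]
    exact add_le_aleph0.2 ⟨mk_le_aleph0, mk_le_aleph0⟩
  exact (Equiv.sigmaSumDistrib _ _).countable_iff.2 inferInstance

/-- For a map `Φ` that assigns to two members of `H(κ)` countably many members of `H(κ)`, there is
a club of countable elementary submodels of `H(κ)` that are closed under `Φ`. -/
theorem exists_club_elementary_closed {κ : Cardinal.{u}} (hne : (hereditary κ).Nonempty)
    (Φ : ZFSet.{u} → ZFSet.{u} → Set ZFSet.{u}) (hc : ∀ x y, (Φ x y).Countable)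
    (hΦ : ∀ x ∈ hereditary κ, ∀ y ∈ hereditary κ, Φ x y ⊆ hereditary κ) :
    ∃ D : Set ZFSet.{u}, ClubInCountableSubsets (hereditary κ) D ∧
      ∀ M ∈ D, CountableElementary κ M ∧ ∀ x ∈ M, ∀ y ∈ M, ∀ z ∈ Φ x y, z ∈ M := by
  have hne' : Nonempty (hereditary κ) := hne.to_subtype
  have hex : ∀ x y : hereditary κ, ∃ f : ℕ → hereditary κ, ∀ z ∈ Φ x y, ∃ n, (f n).1 = z := by
    intro x y
    -- Adding `x` makes the set nonempty, so that ω enumerates it.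
    have hcount : (insert x.1 (Φ x y)).Countable := (hc x y).insert _
    obtain ⟨f, hf⟩ := hcount.exists_eq_range ⟨x.1, mem_insert _ _⟩
    refine ⟨fun n => ⟨f n, ?_⟩, fun z hz => ?_⟩
    · have : f n ∈ insert x.1 (Φ x y) := hf ▸ mem_range_self n
      rcases this with h | h
      · rw [h]; exact x.2
      · exact hΦ x x.2 y y.2 h
    · have : z ∈ range f := hf ▸ mem_insert_of_mem _ hz
      exact this
  choose f hf using hex
  let _ := binaryStructure (A := hereditary κ) fun n x y => f x y n
  -- Substructures for the Skolem functions and the enumerating functions are elementary and closed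
  -- under `Φ`; generated substructures and unions of chains make them a club.
  let D : Set ZFSet.{u} := {M | M ∈ countableSubsets (hereditary κ) ∧
    ∃ S : skolemBinaryLanguage.Substructure (hereditary κ), ∀ x, x ∈ S ↔ x.1 ∈ M}
  refine ⟨D, ⟨fun M hM => hM.1, ?_, ?_⟩, ?_⟩
  · intro Y hY
    let s : Set (hereditary κ) := {x | x.1 ∈ Y}
    have hs : s.Countable := hY.2.preimage Subtype.val_injective
    let S := FirstOrder.Language.Substructure.closure skolemBinaryLanguage s
    have hS : Countable S := hs.substructure_closure skolemBinaryLanguage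
    let Z : ZFSet.{u} := ZFSet.range fun x : S => x.1.1
    have hZ : ∀ z, z ∈ Z ↔ ∃ x : S, x.1.1 = z := fun z => ZFSet.mem_range
    refine ⟨Z, ⟨⟨?_, ?_⟩, S, fun x => ?_⟩, ?_⟩
    · intro z hz
      obtain ⟨x, rfl⟩ := (hZ z).1 hz
      exact x.1.2
    · rw [ZFSet.coe_range]
      exact countable_range _
    · rw [hZ]
      constructor
      · exact fun hx => ⟨⟨x, hx⟩, rfl⟩
      · rintro ⟨y, hy⟩
        rw [← Subtype.ext hy]
        exact y.2
    · intro z hz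
      exact (hZ z).2 ⟨⟨⟨z, hY.1 hz⟩, FirstOrder.Language.Substructure.subset_closure hz⟩, rfl⟩
  · intro Y hY hmono
    choose h1 S hS using hY
    have hmono' : Monotone S := monotone_nat_of_le_succ fun n x hx =>
      (hS _ _).2 (hmono n ((hS _ _).1 hx))
    refine ⟨⟨?_, ?_⟩, ⨆ n, S n, fun x => ?_⟩
    · rw [ZFSet.coe_iUnion]
      exact iUnion_subset fun n => (h1 n).1
    · rw [ZFSet.coe_iUnion]
      exact countable_iUnion fun n => (h1 n).2
    · rw [FirstOrder.Language.Substructure.mem_iSup_of_directed hmono'.directed_le,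
        ZFSet.mem_iUnion]
      simp only [hS]
  · rintro M ⟨hM, S, hS⟩
    refine ⟨⟨hM, FirstOrder.Language.Substructure.elementarySkolem₁Reduct
      (FirstOrder.Language.LHom.sumInl.substructureReduct S), fun x => hS x⟩, ?_⟩
    intro x hx y hy z hz
    obtain ⟨n, hn⟩ := hf ⟨x, hM.1 hx⟩ ⟨y, hM.1 hy⟩ z hz
    rw [← hn, ← hS]
    refine S.fun_mem (Sum.inr (BinaryFun.mk n) : skolemBinaryLanguage.Functions 2)
      ![⟨x, hM.1 hx⟩, ⟨y, hM.1 hy⟩] ?_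
    intro i
    fin_cases i
    · exact (hS _).2 hx
    · exact (hS _).2 hy

/-! ### Hereditary sets and suprema of sets of ordinals -/

theorem mem_hereditary_of_mem {κ : Cardinal.{u}} {x y : ZFSet.{u}} (hx : x ∈ hereditary κ)
    (hy : y ∈ x) : y ∈ hereditary κ := by
  obtain ⟨t, ht, hxt, hcard⟩ := hx
  exact ⟨t, ht, ht.subset_of_mem (hxt hy), hcard⟩

/-- The von Neumann stage at the rank of `x` is a transitive set that includes `x`. -/
theorem exists_isRegular_mem_hereditary (x : ZFSet.{u}) :
    ∃ κ : Cardinal.{u}, κ.IsRegular ∧ x ∈ hereditary κ := by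
  refine ⟨Order.succ (max ℵ₀ (ZFSet.vonNeumann x.rank).card), isRegular_succ (le_max_left _ _),
    _, ZFSet.isTransitive_vonNeumann _, ZFSet.subset_vonNeumann_self x, ?_⟩
  exact Order.lt_succ_iff.2 (le_max_right _ _)

/-- The strict supremum of the ordinals below `o` that are elements of `M`. -/
noncomputable def strictSup (o : Ordinal.{u}) (M : ZFSet.{u}) : Ordinal.{u} :=
  sSup ((· + 1) '' {α | α < o ∧ α.toZFSet ∈ M})

theorem bddAbove_strictSup (o : Ordinal.{u}) (M : ZFSet.{u}) :
    BddAbove ((· + 1) '' {α | α < o ∧ α.toZFSet ∈ M}) := by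
  refine ⟨o, ?_⟩
  rintro _ ⟨α, hα, rfl⟩
  exact Order.add_one_le_of_lt hα.1

theorem lt_strictSup {o α : Ordinal.{u}} {M : ZFSet.{u}} (hα : α < o) (hM : α.toZFSet ∈ M) :
    α < strictSup o M :=
  (lt_add_one α).trans_le (le_csSup (bddAbove_strictSup o M) ⟨α, ⟨hα, hM⟩, rfl⟩)

theorem strictSup_le {o b : Ordinal.{u}} {M : ZFSet.{u}}
    (h : ∀ α < o, α.toZFSet ∈ M → α < b) : strictSup o M ≤ b := by
  refine csSup_le' ?_
  rintro _ ⟨α, hα, rfl⟩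
  exact Order.add_one_le_of_lt (h α hα.1 hα.2)

theorem exists_of_lt_strictSup {o x : Ordinal.{u}} {M : ZFSet.{u}} (h : x < strictSup o M) :
    ∃ α < o, α.toZFSet ∈ M ∧ x ≤ α := by
  by_contra! hcon
  exact h.not_ge (strictSup_le hcon)

theorem strictSup_lt {o : Ordinal.{u}} (ho : ℵ₀ < o.cof) {M : ZFSet.{u}}
    (hM : (M : Set ZFSet.{u}).Countable) : strictSup o M < o := by
  refine sSup_add_one_lt_of_lt_cof ?_ fun α hα => hα.1
  have hc : {α | α < o ∧ α.toZFSet ∈ M}.Countable :=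
    (hM.preimage toZFSet_injective).mono fun α hα => hα.2
  refine (le_aleph0_iff_set_countable.2 hc).trans_lt ?_
  rw [← lift_cof]
  exact aleph0_lt_lift.2 ho

theorem exists_seq_of_cof_eq_aleph0 {γ : Ordinal.{u}} (hγ : γ.cof = ℵ₀) :
    ∃ a : ℕ → Ordinal.{u}, (∀ n, a n < γ) ∧ ∀ η < γ, ∃ n, η ≤ a n := by
  obtain ⟨s, hs, hcard⟩ := Order.exists_cof_eq (Iio γ)
  have hc : Order.cof (Iio γ) = ℵ₀ := by rw [cof_Iio, ← lift_cof, hγ, lift_aleph0]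
  have hsc : s.Countable := le_aleph0_iff_set_countable.1 (hcard.trans hc).le
  have hne : s.Nonempty := by
    rw [nonempty_iff_ne_empty]
    rintro rfl
    rw [hc, mk_eq_zero] at hcard
    exact aleph0_ne_zero hcard.symm
  obtain ⟨a, ha⟩ := hsc.exists_eq_range hne
  refine ⟨fun n => a n, fun n => (a n).2, fun η hη => ?_⟩
  obtain ⟨x, hx, hηx⟩ := hs ⟨η, hη⟩
  rw [ha] at hx
  obtain ⟨n, rfl⟩ := hx
  exact ⟨n, hηx⟩

/-! ### The set mapping and its reflecting sequence -/

/-- A club of countable subsets of `θ` has, for some `γ` in a given stationary set of ordinals of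
cofinality `ω`, a sequence of elements that are bounded below `γ` but have members cofinal
in `γ`. -/
theorem exists_seq_mem_club {o : Ordinal.{u}} (ho : o.cof.ord = o) (hω : ℵ₀ < o.cof)
    {E : Set ZFSet.{u}} (hE : ClubInCountableSubsets (o.toZFSet : Set ZFSet.{u}) E)
    {S : Set Ordinal.{u}} (hS : StationaryIn o S) (hSω : S ⊆ cofOmega o) :
    ∃ γ ∈ S, ∃ Y : ℕ → ZFSet.{u}, (∀ n, Y n ∈ E) ∧ ∀ η < γ, ∃ n, ∃ η', η ≤ η' ∧ η' < γ ∧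
      η'.toZFSet ∈ Y n ∧ ∃ ζ < γ, ∀ α, α.toZFSet ∈ Y n → α < ζ := by
  have hex : ∀ η, ∃ Y, η < o → Y ∈ E ∧ η.toZFSet ∈ Y := by
    intro η
    by_cases hη : η < o
    · have hηo : (({η.toZFSet} : ZFSet.{u}) : Set ZFSet.{u}) ⊆ o.toZFSet := by
        rw [ZFSet.coe_singleton, singleton_subset_iff]
        exact toZFSet_mem_toZFSet_iff.2 hη
      obtain ⟨Z, hZ, hZ'⟩ := hE.unbounded {η.toZFSet} ⟨hηo, by simp⟩
      exact ⟨Z, fun _ => ⟨hZ, hZ' (by simp)⟩⟩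
    · exact ⟨∅, fun h => absurd h hη⟩
  choose Y hY using hex
  obtain ⟨γ, hγS, hγo, -, hγ⟩ := hS.exists_closurePoint ho hω (h := fun η => strictSup o (Y η))
    fun η hη => strictSup_lt hω (hE.subset (hY η hη).1).2
  -- Countable cofinality reduces the family `Y η`, η < γ, to a sequence, which a countable model
  -- can contain termwise.
  obtain ⟨a, ha, ha'⟩ := exists_seq_of_cof_eq_aleph0 (hSω hγS).2
  refine ⟨γ, hγS, fun n => Y (a n), fun n => (hY _ ((ha n).trans hγo)).1, fun η hη => ?_⟩
  obtain ⟨n, hn⟩ := ha' η hη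
  have hn' := hY _ ((ha n).trans hγo)
  refine ⟨n, a n, hn, ha n, hn'.2, _, hγ _ (ha n), fun α hα => lt_strictSup ?_ hα⟩
  exact toZFSet_mem_toZFSet_iff.1 ((hE.subset hn'.1).1 hα)

/-- The reflecting sequence that `MRP` gives, read off in terms of ordinals. -/
theorem MRP.exists_seq (hMRP : MRP.{u}) {o : Ordinal.{u}} (ho : o.cof.ord = o)
    (hω₁ : ω₁ < o) {Ω : Set Ordinal.{u}} (hΩ : Ω ⊆ cofOmega o)
    {C : Ordinal.{u} → Set Ordinal.{u}} (hC : IsCSequence C o) (hCΩ : Avoids C o Ω)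
    {d : Ordinal.{u} → Set Ordinal.{u}} (hd : ∀ i, d i ⊆ Ω ∧ StationaryIn o (d i))
    {g : Ordinal.{u} → Ordinal.{u}} (hg : ∀ β, 0 < β → g β < β) :
    ∃ f e : Ordinal.{u} → Ordinal.{u},
      (∀ ν < ω₁, f ν < o) ∧ (∀ ν < ω₁, e ν < ω₁) ∧
      (∀ ν < ω₁, ∀ ξ < ν, f ξ < f ν) ∧ (∀ ν < ω₁, ∀ ξ < ν, e ξ < e ν) ∧
      (∀ ν < ω₁, Order.IsSuccLimit ν → ∀ x < f ν, ∃ ξ < ν, x < f ξ) ∧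
      (∀ ν < ω₁, Order.IsSuccLimit ν → ∀ x < e ν, ∃ ξ < ν, x < e ξ) ∧
      ∀ ν < ω₁, Order.IsSuccLimit ν → ∃ ν₀ < ν, ∀ ξ, ν₀ < ξ → ξ < ν →
        ∃ γ ∈ d (g (e ν)), γ < f ν ∧ γ ∈ tr C (f ξ) (f ν) := by
  have hcof₁ : ℵ₀ < (ω₁ : Ordinal.{u}).cof := by
    rw [cof_omega_one]; exact aleph0_lt_aleph_one
  have hω : ℵ₀ < o.cof := by
    rw [← ord_lt_ord, ho, ord_aleph0]
    exact omega0_lt_omega_one.trans hω₁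
  have hlim : ∀ γ ∈ Ω, Order.IsSuccLimit γ := by
    intro γ hγ
    refine one_lt_cof_iff.1 ?_
    rw [(hΩ hγ).2]
    exact one_lt_aleph0
  set X := o.toZFSet with hX
  obtain ⟨κ, hκ, hXκ⟩ := exists_isRegular_mem_hereditary (countableSubsetsSet X)
  have hmemX : ∀ α : Ordinal.{u}, α.toZFSet ∈ X ↔ α < o := fun α => toZFSet_mem_toZFSet_iff
  have hκo : ∀ α < o, α.toZFSet ∈ hereditary κ := by
    intro α hα
    have h1 : ({α.toZFSet} : ZFSet.{u}) ∈ countableSubsetsSet X := by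
      rw [← SetLike.mem_coe, coe_countableSubsetsSet]
      exact ⟨by simpa using (hmemX α).2 hα, by simp⟩
    exact mem_hereditary_of_mem (mem_hereditary_of_mem hXκ h1) (by simp)
  have hresp : ∀ (E : ZFSet.{u}) (i : Ordinal.{u}), ∃ γ, ∃ Y : ℕ → ZFSet.{u},
      ClubInCountableSubsets (X : Set ZFSet.{u}) (E : Set ZFSet.{u}) →
      γ ∈ d i ∧ (∀ n, Y n ∈ E) ∧ ∀ η < γ, ∃ n, ∃ η', η ≤ η' ∧ η' < γ ∧
      η'.toZFSet ∈ Y n ∧ ∃ ζ < γ, ∀ α, α.toZFSet ∈ Y n → α < ζ := by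
    intro E i
    by_cases hE : ClubInCountableSubsets (X : Set ZFSet.{u}) (E : Set ZFSet.{u})
    · obtain ⟨γ, hγ, Y, hY⟩ := exists_seq_mem_club ho hω hE (hd i).2 ((hd i).1.trans hΩ)
      exact ⟨γ, Y, fun _ => ⟨hγ, hY⟩⟩
    · exact ⟨0, fun _ => ∅, fun h => absurd h hE⟩
  choose γ Y hγY using hresp
  -- The first clause makes M ∩ ω₁ an initial segment. The second makes both suprema increase
  -- strictly along an ∈-chain. The third answers a club `x` for the index i, which is passed as the
  -- von Neumann ordinal `y` of rank i.
  let Φ : ZFSet.{u} → ZFSet.{u} → Set ZFSet.{u} := fun x y =>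
    {z | (x : Set ZFSet.{u}).Countable ∧ z ∈ x} ∪
    toZFSet '' {α | α < o ∧ (α = 0 ∨ α = strictSup o x ∨ α = strictSup ω₁ x)} ∪
    {z | ClubInCountableSubsets (X : Set ZFSet.{u}) (x : Set ZFSet.{u}) ∧
      (z = (γ x y.rank).toZFSet ∨ z ∈ range (Y x y.rank))}
  obtain ⟨D, hD, hDM⟩ := exists_club_elementary_closed (κ := κ) ⟨_, hXκ⟩ Φ
    (by
      intro x y
      refine Set.Countable.union (Set.Countable.union ?_ ?_) ?_
      · by_cases hx : (x : Set ZFSet.{u}).Countable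
        · exact hx.mono fun z hz => hz.2
        · exact countable_empty.mono fun z hz => hx hz.1
      · refine Set.Countable.image (Set.Countable.mono
          (s₂ := {0, strictSup o x, strictSup ω₁ x}) ?_ (by simp)) _
        rintro α ⟨-, hα⟩
        exact hα
      · refine ((countable_range (Y x y.rank)).insert (γ x y.rank).toZFSet).mono ?_
        rintro z ⟨-, hz⟩
        exact hz)
    (by
      rintro x hx y hy z ((⟨-, hz⟩ | ⟨α, ⟨hα, -⟩, rfl⟩) | ⟨hE, rfl | ⟨n, rfl⟩⟩)
      · exact mem_hereditary_of_mem hx hz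
      · exact hκo α hα
      · exact hκo _ (hΩ ((hd _).1 (hγY x _ hE).1)).1
      · exact mem_hereditary_of_mem hx ((hγY x _ hE).2.1 n))
  have hcount : ∀ M ∈ D, (M : Set ZFSet.{u}).Countable := fun M hM => (hD.subset hM).2
  have hsub : ∀ M ∈ D, ∀ x ∈ M, (x : Set ZFSet.{u}).Countable → x ⊆ M := fun M hM x hx hxc z hz =>
    (hDM M hM).2 x hx x hx z (.inl (.inl ⟨hxc, hz⟩))
  have hgM : ∀ M ∈ D, (g (strictSup ω₁ M)).toZFSet ∈ M := by
    intro M hM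
    obtain ⟨x, hx⟩ : ∃ x, x ∈ M := by
      obtain ⟨S, hS⟩ := (hDM M hM).1.2
      have : Nonempty (hereditary κ) := ⟨_, hXκ⟩
      obtain ⟨x⟩ := (inferInstance : Nonempty S)
      exact ⟨x.1.1, (hS _).1 x.2⟩
    have h0 : (0 : Ordinal.{u}).toZFSet ∈ M := (hDM M hM).2 x hx x hx _
      (.inl (.inr ⟨0, ⟨(zero_le (a := ω₁)).trans_lt hω₁, .inl rfl⟩, rfl⟩))
    have hpos : 0 < strictSup ω₁ M := lt_strictSup (omega_pos 1) h0
    -- The value of g is below sup(M ∩ ω₁), hence at most some countable α ∈ M, and α ⊆ M.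
    obtain ⟨α, hα, hαM, hle⟩ := exists_of_lt_strictSup (hg _ hpos)
    rcases hle.eq_or_lt with h | h
    · rwa [h]
    · refine hsub M hM _ hαM ?_ (toZFSet_mem_toZFSet_iff.2 h)
      rw [coe_toZFSet]
      refine Set.Countable.image ?_ _
      rw [← le_aleph0_iff_set_countable, Cardinal.mk_Iio_ordinal, lift_le_aleph0, card_le_iff]
      simpa using hα
  let Sig : ZFSet.{u} → Set ZFSet.{u} := fun M =>
    {Z | Z ∈ countableSubsets (X : Set ZFSet.{u}) ∧ ∃ γ ∈ d (g (strictSup ω₁ M)),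
      γ < strictSup o M ∧ ∃ η < γ, η.toZFSet ∈ Z ∧ (∃ ζ < γ, ∀ α, α.toZFSet ∈ Z → α < ζ) ∧
        ∀ α, η ≤ α → α < γ → γ ∈ tr C α (strictSup o M)}
  have hSig : OpenStationaryMapping X κ D Sig := by
    refine ⟨hD, fun M hM => (hDM M hM).1, fun M hM => ⟨fun Z hZ => hZ.1, ?_⟩, ?_⟩
    · have key : ∀ Z : countableSubsets (X : Set ZFSet.{u}), Z.1 ∈ Sig M →
          ∃ U, (ellentuck X).IsOpen U ∧ Z ∈ U ∧ U ⊆ Subtype.val ⁻¹' Sig M := by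
        rintro Z ⟨hZ, γ, hγ, hγM, η, hη, hηZ, ⟨ζ, hζ, hζZ⟩, htr⟩
        -- The interval [{η}, Z] keeps the element η, and its members inherit the bound ζ.
        refine ⟨{W | ({η.toZFSet} : ZFSet.{u}) ⊆ W.1 ∧ W.1 ⊆ Z.1},
          TopologicalSpace.isOpen_generateFrom_of_mem
            ⟨{η.toZFSet}, Z.1, hZ, ?_, by simp, rfl⟩, ⟨?_, fun _ h => h⟩, ?_⟩
        · intro z hz
          rw [ZFSet.mem_singleton] at hz
          rwa [hz]
        · intro z hz
          rw [ZFSet.mem_singleton] at hz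
          rwa [hz]
        · rintro W ⟨hW, hWZ⟩
          exact ⟨W.2, γ, hγ, hγM, η, hη, hW (by simp),
            ⟨ζ, hζ, fun α hα => hζZ α (hWZ hα)⟩, htr⟩
      choose U hU hZU hUS using key
      let _ := ellentuck X
      have : (Subtype.val ⁻¹' Sig M : Set (countableSubsets (X : Set ZFSet.{u}))) =
          ⋃ Z, ⋃ h, U Z h := by
        ext Z
        simp only [mem_iUnion]
        exact ⟨fun h => ⟨Z, h, hZU Z h⟩, fun ⟨W, h, hZ⟩ => hUS W h hZ⟩
      rw [this]
      exact isOpen_iUnion fun Z => isOpen_iUnion fun h => hU Z h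
    · intro M hM E hEM hE
      set i := g (strictSup ω₁ M) with hi
      have hγM : (γ E i).toZFSet ∈ M := (hDM M hM).2 E hEM _ (hgM M hM) _
        (.inr ⟨hE, .inl (by rw [rank_toZFSet])⟩)
      have hYM : ∀ n, Y E i n ∈ M := fun n => (hDM M hM).2 E hEM _ (hgM M hM) _
        (.inr ⟨hE, .inr (by rw [rank_toZFSet]; exact mem_range_self n)⟩)
      obtain ⟨hγd, hYE, hY⟩ := hγY E i hE
      have hγΩ := (hd i).1 hγd
      have hlt := lt_strictSup (hΩ hγΩ).1 hγM
      obtain ⟨η, hη, htr⟩ := exists_forall_mem_tr hC hCΩ hγΩ (hlim _ hγΩ) hlt.le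
        (strictSup_lt hω (hcount M hM))
      -- The threshold η depends on sup(M ∩ θ) and need not be in M; cofinality of the sequence
      -- supplies a term with an element beyond it.
      obtain ⟨n, η', hηη', hη', hη'Y, hζ⟩ := hY η hη
      exact ⟨Y E i n, hYE n, ⟨hE.subset (hYE n), γ E i, hγd, hlt, η', hη', hη'Y, hζ,
        fun α hα hαγ => htr α (hηη'.trans hα) hαγ⟩, hYM n⟩
  have hXunc : ¬ (X : Set ZFSet.{u}).Countable := by
    intro h
    rw [hX, coe_toZFSet] at h
    have h2 : (Iio o).Countable := by
      have := h.preimage toZFSet_injective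
      rwa [preimage_image_eq _ toZFSet_injective] at this
    rw [← le_aleph0_iff_set_countable, Cardinal.mk_Iio_ordinal, lift_le_aleph0] at h2
    have h3 : o.cof ≤ ℵ₀ := (cof_le_card o).trans h2
    exact hω.not_ge h3
  obtain ⟨N, hN⟩ := hMRP X κ D Sig hXunc hκ hXκ hSig
  have hstep : ∀ ν < ω₁, ∀ ξ < ν, ∀ α < o, (α = strictSup o (N ξ) ∨ α = strictSup ω₁ (N ξ)) →
      α.toZFSet ∈ N ν := fun ν hν ξ hξ α hα h =>
    (hDM _ (hN.mem_domain ν hν)).2 _ (hN.chain ν hν ξ hξ) _ (hN.chain ν hν ξ hξ) _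
      (.inl (.inr ⟨α, ⟨hα, .inr h⟩, rfl⟩))
  have hf : ∀ ν < ω₁, strictSup o (N ν) < o := fun ν hν =>
    strictSup_lt hω (hcount _ (hN.mem_domain ν hν))
  have he : ∀ ν < ω₁, strictSup ω₁ (N ν) < ω₁ := fun ν hν =>
    strictSup_lt hcof₁ (hcount _ (hN.mem_domain ν hν))
  have hcont : ∀ ν < ω₁, Order.IsSuccLimit ν → ∀ p, ∀ x < strictSup p (N ν),
      ∃ ξ < ν, x < strictSup p (N ξ) := by
    intro ν hν hνlim p x hx
    obtain ⟨α, hα, hαN, hxα⟩ := exists_of_lt_strictSup hx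
    obtain ⟨ξ, hξ, hαξ⟩ := (hN.continuous ν hν hνlim _).1 hαN
    exact ⟨ξ, hξ, hxα.trans_lt (lt_strictSup hα hαξ)⟩
  refine ⟨fun ν => strictSup o (N ν), fun ν => strictSup ω₁ (N ν), hf, he,
    fun ν hν ξ hξ => lt_strictSup (hf ξ (hξ.trans hν))
      (hstep ν hν ξ hξ _ (hf ξ (hξ.trans hν)) (.inl rfl)),
    fun ν hν ξ hξ => lt_strictSup (he ξ (hξ.trans hν))
      (hstep ν hν ξ hξ _ ((he ξ (hξ.trans hν)).trans hω₁) (.inr rfl)),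
    fun ν hν hνlim => hcont ν hν hνlim o, fun ν hν hνlim => hcont ν hν hνlim ω₁, ?_⟩
  intro ν hν hνlim
  obtain ⟨ν₀, hν₀, hrefl⟩ := hN.reflects ν hν hνlim
  refine ⟨ν₀, hν₀, fun ξ h1 h2 => ?_⟩
  obtain ⟨-, γ', hγ', hγN, η, hη, hηN, ⟨ζ, hζ, hζN⟩, htr⟩ := hrefl ξ h1 h2
  refine ⟨γ', hγ', hγN, htr _ ?_ ?_⟩
  -- The element η and the bound ζ place sup(N_ξ ∩ θ) in the interval [η, γ).
  · rw [ZFSet.mem_inter, hmemX] at hηN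
    exact (lt_strictSup hηN.2 hηN.1).le
  · refine (strictSup_le fun α hα hαN => ?_).trans_lt hζ
    exact hζN α (ZFSet.mem_inter.2 ⟨hαN, (hmemX α).2 hα⟩)

/-! ### Clubs in the supremum of a continuous `ω₁`-sequence -/

theorem ord_cof_omega_one : (ω₁ : Ordinal.{u}).cof.ord = ω₁ := by
  rw [cof_omega_one, ord_aleph]

theorem aleph0_lt_cof_omega_one : ℵ₀ < (ω₁ : Ordinal.{u}).cof := by
  rw [cof_omega_one]
  exact aleph0_lt_aleph_one

/-- Let `f` be a continuous increasing sequence of length `ω₁` with supremum `δ`. Then every club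
`E` in `δ` is hit by `f` at some member of a given stationary set that is a closure point of `h`
and a limit of points at which `f` hits `E`. -/
theorem exists_closurePoint_mem_club {f : Ordinal.{u} → Ordinal.{u}} {δ : Ordinal.{u}}
    (hmono : ∀ ν < ω₁, ∀ ξ < ν, f ξ < f ν)
    (hcont : ∀ ν < ω₁, Order.IsSuccLimit ν → ∀ x < f ν, ∃ ξ < ν, x < f ξ)
    (hδ : ∀ ν < ω₁, f ν < δ) (hδ' : ∀ x < δ, ∃ ν < ω₁, x < f ν)
    {E : Set Ordinal.{u}} (hE : ClubIn δ E) {h : Ordinal.{u} → Ordinal.{u}}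
    (hh : ∀ ξ < ω₁, h ξ < ω₁) {T : Set Ordinal.{u}} (hT : StationaryIn ω₁ T) :
    ∃ ν ∈ T, ν < ω₁ ∧ Order.IsSuccLimit ν ∧ (∀ ξ < ν, h ξ < ν) ∧ f ν ∈ E ∧
      ∀ ξ < ν, ∃ ξ', ξ < ξ' ∧ ξ' < ν ∧ f ξ' ∈ E := by
  have hω₁ : Order.IsSuccLimit (ω₁ : Ordinal.{u}) := isSuccLimit_omega 1
  have hclosed : ∀ ν < ω₁, Order.IsSuccLimit ν →
      (∀ ξ < ν, ∃ x ∈ E, f ξ < x ∧ x < f ν) → f ν ∈ E := by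
    intro ν hν hlim hx
    refine hE.mem_of_isLUB (s := {x ∈ E | x < f ν}) (fun x hx => hx.1) ?_
      ⟨fun x hx => hx.2.le, fun b hb => ?_⟩ (hδ ν hν)
    · obtain ⟨x, hxE, -, hxν⟩ := hx 0 hlim.bot_lt
      exact ⟨x, hxE, hxν⟩
    · by_contra! hlt
      obtain ⟨ξ, hξ, hbξ⟩ := hcont ν hν hlim b hlt
      obtain ⟨x, hxE, hξx, hxν⟩ := hx ξ hξ
      exact (hbξ.trans hξx).not_ge (hb ⟨hxE, hxν⟩)
  -- Closure under k makes f ν a limit of points of `E`; l then picks such closure points, and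
  -- closure under l makes ν a limit of them.
  have hex : ∀ ξ, ∃ k, ξ < ω₁ → k < ω₁ ∧ ξ < k ∧ ∃ x ∈ E, f ξ < x ∧ x < f k := by
    intro ξ
    by_cases hξ : ξ < ω₁
    · obtain ⟨x, hxE, hx⟩ := hE.exists_ge (hδ _ (hω₁.add_one_lt hξ))
      obtain ⟨k, hk, hxk⟩ := hδ' x (hE.1 hxE)
      have hfx := (hmono _ (hω₁.add_one_lt hξ) ξ (lt_add_one ξ)).trans_le hx
      refine ⟨k, fun _ => ⟨hk, ?_, x, hxE, hfx, hxk⟩⟩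
      by_contra! hle
      rcases hle.eq_or_lt with rfl | hlt
      · exact (hfx.trans hxk).false
      · exact ((hmono ξ hξ k hlt).trans (hfx.trans hxk)).false
    · exact ⟨0, fun h => absurd h hξ⟩
  choose k hk using hex
  have hlimk : ∀ ν ≤ ω₁, 0 < ν → (∀ ξ < ν, k ξ < ν) → Order.IsSuccLimit ν := fun ν hν h0 hkν =>
    isSuccLimit_of_closurePoint h0 fun ξ hξ => ⟨(hk ξ (hξ.trans_le hν)).2.1, hkν ξ hξ⟩
  have hmem : ∀ ν < ω₁, 0 < ν → (∀ ξ < ν, k ξ < ν) → f ν ∈ E := by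
    intro ν hν h0 hkν
    refine hclosed ν hν (hlimk ν hν.le h0 hkν) fun ξ hξ => ?_
    obtain ⟨-, -, x, hxE, hξx, hxk⟩ := hk ξ (hξ.trans hν)
    exact ⟨x, hxE, hξx, hxk.trans (hmono ν hν _ (hkν ξ hξ))⟩
  have hex' : ∀ ξ, ∃ l, ξ < ω₁ → l < ω₁ ∧ ξ < l ∧ f l ∈ E := by
    intro ξ
    by_cases hξ : ξ < ω₁
    · obtain ⟨l, hl, hle⟩ := (clubIn_closurePoints ord_cof_omega_one aleph0_lt_cof_omega_one
        fun η hη => (hk η hη).1).exists_ge (hω₁.add_one_lt hξ)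
      exact ⟨l, fun _ => ⟨hl.1, (lt_add_one ξ).trans_le hle, hmem l hl.1 hl.2.1 hl.2.2⟩⟩
    · exact ⟨0, fun h => absurd h hξ⟩
  choose l hl using hex'
  obtain ⟨ν, hνT, hν, hν0, hcl⟩ := hT.exists_closurePoint ord_cof_omega_one
    aleph0_lt_cof_omega_one (h := fun ξ => max (h ξ) (max (k ξ) (l ξ)))
    fun ξ hξ => max_lt (hh ξ hξ) (max_lt (hk ξ hξ).1 (hl ξ hξ).1)
  have hkν : ∀ ξ < ν, k ξ < ν := fun ξ hξ =>
    ((le_max_left _ _).trans (le_max_right _ _)).trans_lt (hcl ξ hξ)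
  refine ⟨ν, hνT, hν, hlimk ν hν.le hν0 hkν, fun ξ hξ => (le_max_left _ _).trans_lt (hcl ξ hξ),
    hmem ν hν hν0 hkν, fun ξ hξ => ⟨l ξ, (hl ξ (hξ.trans hν)).2.1, ?_, (hl ξ (hξ.trans hν)).2.2⟩⟩
  exact ((le_max_right _ _).trans (le_max_right _ _)).trans_lt (hcl ξ hξ)

end TraceReflection

/-! ### The common reflection point -/

theorem mainTheorem1 (hMRP : TraceReflection.MRP.{u})
    (θ : Cardinal.{u}) (hθ : θ.IsRegular) (hθ₁ : Cardinal.aleph 1 < θ)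
    (Ω : Set Ordinal.{u}) (hΩ : Ω ⊆ TraceReflection.cofOmega θ.ord)
    (hΩ_stat : TraceReflection.StationaryIn θ.ord Ω)
    (hΩ_nonrefl : ¬ TraceReflection.Reflects θ.ord Ω)
    (C : Ordinal.{u} → Set Ordinal.{u}) (hC : TraceReflection.IsCSequence C θ.ord)
    (hCΩ : TraceReflection.Avoids C θ.ord Ω)
    (F : Set (Set Ordinal.{u})) (hF_card : Cardinal.mk F = Cardinal.aleph 1)
    (hF : ∀ X ∈ F, X ⊆ Ω ∧ TraceReflection.StationaryIn θ.ord X) :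
    ∃ δ < θ.ord, δ.cof = Cardinal.aleph 1 ∧
      ∀ X ∈ F, TraceReflection.TraceReflectsAt C θ.ord X δ := by
  open TraceReflection Set Cardinal Ordinal in
  have hreg : θ.ord.cof.ord = θ.ord := by rw [hθ.cof_ord]
  have hω₁θ : ω₁ < θ.ord := by rwa [← ord_aleph, ord_lt_ord]
  have hω₁ : Order.IsSuccLimit (ω₁ : Ordinal.{u}) := isSuccLimit_omega 1
  have hne : Nonempty F := by
    rw [← mk_ne_zero_iff, hF_card]
    exact (aleph_pos 1).ne'
  obtain ⟨g, d, hg, hd⟩ := exists_regressive_stationary_fibers hF_card.le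
  obtain ⟨f, e, hfθ, heω, hf, he, hfc, hec, hrefl⟩ := hMRP.exists_seq hreg hω₁θ hΩ hC hCΩ
    (d := fun i => (d i).1) (fun i => hF _ (d i).2) hg
  let δ : Ordinal.{u} := ⨆ ν : Iio (ω₁ : Ordinal.{u}), f ν
  have hfmono : StrictMono fun ν : Iio (ω₁ : Ordinal.{u}) => f ν := fun ξ ν h => hf ν ν.2 ξ h
  have hδ : ∀ ν < ω₁, f ν < δ := fun ν hν =>
    (hf _ (hω₁.add_one_lt hν) ν (lt_add_one ν)).trans_le
      (le_ciSup (f := fun ν : Iio (ω₁ : Ordinal.{u}) => f ν) Ordinal.bddAbove_of_small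
        ⟨ν + 1, hω₁.add_one_lt hν⟩)
  have hδ' : ∀ x < δ, ∃ ν < ω₁, x < f ν := by
    intro x hx
    have : Nonempty (Iio (ω₁ : Ordinal.{u})) := ⟨0, hω₁.bot_lt⟩
    obtain ⟨ν, hν⟩ := (lt_ciSup_iff Ordinal.bddAbove_of_small).1 hx
    exact ⟨ν, ν.2, hν⟩
  have hδθ : δ < θ.ord := by
    refine lift_iSup_lt_of_lt_cof ?_ fun ν => hfθ ν ν.2
    rw [Cardinal.mk_Iio_ordinal, Cardinal.lift_lift, ← lift_cof, Cardinal.lift_lt, hθ.cof_ord]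
    simpa using hθ₁
  have hδcof : δ.cof = ℵ₁ := by
    rw [← cof_omega_one]
    exact cof_iSup_Iio hfmono hω₁.isSuccPrelimit
  have hℵ₀θ : ℵ₀ < θ.ord.cof := by
    rw [hθ.cof_ord]
    exact aleph0_lt_aleph_one.trans hθ₁
  refine ⟨δ, hδθ, hδcof, fun X hX => ⟨(hF X hX).2.mem_traceHitting hreg hℵ₀θ
    fun γ hγ => (hΩ ((hF X hX).1 hγ)).1, hδθ, ?_, inter_subset_right, fun E hE => ?_⟩⟩
  · rw [hδcof]
    exact aleph0_lt_aleph_one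
  obtain ⟨ν, hνT, hν, hlim, heν, hνE, hνE'⟩ :=
    exists_closurePoint_mem_club hf hfc hδ hδ' hE heω (hd ⟨X, hX⟩)
  have hle : ∀ ξ ≤ ν, ξ ≤ e ξ := by
    intro ξ
    induction ξ using WellFoundedLT.induction with
    | _ ξ ih =>
    intro hξ
    refine le_of_forall_lt fun x hx => ?_
    exact (ih x hx (hx.le.trans hξ)).trans_lt (he ξ (hξ.trans_lt hν) x hx)
  -- Continuity and closure of ν under e give e ν ≤ ν. Hence the set reflected at ν is the one coded
  -- by g ν, namely X.
  have heq : e ν = ν := by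
    refine le_antisymm ?_ (hle ν le_rfl)
    refine le_of_forall_lt fun x hx => ?_
    obtain ⟨ξ, hξ, hxξ⟩ := hec ν hν hlim x hx
    exact hxξ.trans (heν ξ hξ)
  obtain ⟨ν₀, hν₀, hr⟩ := hrefl ν hν hlim
  obtain ⟨ξ, hν₀ξ, hξ, hξE⟩ := hνE' ν₀ hν₀
  obtain ⟨γ, hγ, hγν, htr⟩ := hr ξ hν₀ξ hξ
  have hdν : (d (g (e ν))).1 = X := by
    rw [heq]
    exact congrArg Subtype.val (show d (g ν) = ⟨X, hX⟩ from hνT)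
  exact ⟨f ξ, hξE, f ν, hνE, hf ν hν ξ hξ, γ, htr, hdν ▸ hγ, hγν.trans (hδ ν hν)⟩
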